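/- **Setting.** Programs are function-free answer set programs (normal rules, constraints, choice rules) over a fixed set of predicates and a fixed non-empty set of constants, over which rules are grounded; $AS(\Pi)$ denotes the set of answer sets of $\Pi$. A *NeuralFastLAS task* $T=\langle B,M,E,\mathcal Z,\Theta\rangle$ consists of a background program $B$; a mode bias $M$ with head declarations $M_h$ and body declarations $M_b$ (and possibly further syntactic constraints on rules), whose hypothesis space $S_M$, the set of all normal rules that comply with $M$, is finite; a finite set $E$ of examples $e=\langle e_{id},\langle e^{inc},e^{exc}\rangle,e_{raw}\rangle$, where $e^{inc},e^{exc}$ are disjoint sets of ground atoms and $e_{raw}$ is raw data; a finite latent space $\mathcal Z=\mathcal Z_1\times\dots\times\mathcal Z_n$; and a parameter space $\Theta$, where each $\theta\in\Theta$ gives for each raw input $x$ a probability distribution $P_\theta(\cdot\mid x)$ on $\mathcal Z$. The task is *non-recursive*: no predicate of $M_h$ occurs in $M_b$ or in the body of a rule of $B$. Let $P_{\mathcal Z}$ be the program with the choice rules $1\{nn(i,c): c\in\mathcal Z_i\}1$ for $1\le i\le n$. For each $e\in E$ the *possibilities* are $\mathrm{poss}(e)=AS(B\cup P_{\mathcal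 Z})$. A program *accepts* $e$ if some answer set of it contains $e^{inc}$ and is disjoint from $e^{exc}$; $\mathrm{cov}(H,e)$ is the set of $z\in\mathcal Z$ for which there is $A\in AS(B\cup P_{\mathcal Z})$ whose $nn$-atoms (those $nn(i,c)$ with $c\in\mathcal Z_i$) are exactly the $nn(i,z_i)$ and such that $A\cup H$ accepts $e$. A pair $(H,\theta)$ is a *solution* of $T$ if $H\subseteq S_M$ and for each $e\in E$ there is $z\in\mathrm{cov}(H,e)$ with $P_\theta(z\mid e_{raw})>0$. The parameter $\theta^*$ is *perfect* if $P_{\theta^*}(z^{gt}(x)\mid x)=1$ for every raw input $x$, where $z^{gt}(x)$ is its ground truth latent label; so $(H,\theta^*)$ is a solution iff $H\subseteq S_M$ and $z^{gt}(e_{raw})\in\mathrm{cov}(H,e)$ for all $e\in E$. The length $\mathcal S_{len}(H)$ is the total number of literals (heads included) of the rules of $H$. **The opt-sufficient subset.** Write $r'\le r$ ($r'$ is a subrule of $r$) if the heads agree and the body of $r'$ is contained in that of $r$. A rule proves a ground atom $a$ in a possibility $p$ if it has a ground instance with head $a$ and body true in $p$. For $e\in E$ and $p\in\mathrm{poss}(e)$,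 let $C^+(T,p)$ (respectively $C^-(T,p)$) be the set of the $\le$-maximal rules among the rules of $S_M$ that prove in $p$ at least one atom of $e^{inc}$ (respectively $e^{exc}$), and let $C^+(T)$ be the union of all $C^+(T,p)$. A rule *violates* $p$ if it is a subrule of a rule in $C^-(T,p)$. Let $G(T)$ be the set of all intersections (common head, intersection of the bodies) of non-empty families of rules of $C^+(T)$ with the same head that do not violate every possibility of some example. Two rules *cover the same possibilities* if, for all $e\in E$ and $p\in\mathrm{poss}(e)$, they prove the same atoms of $e^{inc}$ in $p$, and one violates $p$ iff the other does. For a rule $r$, $\mathrm{opt}(r)$ is the set of the rules $r'\in S_M$ such that 1. $r'\le r$; 2. there is no $r''\in S_M$ with $r''<r'$ that covers the same possibilities as $r'$; 3. there is no $e\in E$ such that $r'$ violates every $p\in\mathrm{poss}(e)$; 4. $r'$ has the smallest length among the rules that satisfy (1), (2), (3) and cover the same possibilities as $r'$. Finally $S_M^{\mathrm{opt}}=\bigcup_{r\in G(T)}\mathrm{opt}(r)$. **Theorem.** Let $T$ be a NeuralFastLAS task and $\theta^*$ a perfect network, and suppose that $(H_0,\theta^*)$ is a solution of $T$ for at least one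 hypothesis $H_0$. Then there is a hypothesis $H\subseteq S_M^{\mathrm{opt}}$ such that $(H,\theta^*)$ is a solution of $T$ and $\mathcal S_{len}(H)\le\mathcal S_{len}(H')$ for every hypothesis $H'$ such that $(H',\theta^*)$ is a solution of $T$. -/

import Mathlib

namespace NeuralFastLAS

/-! ### Answer set programs -/

/-- A (function-free) term: a variable or a constant. -/
inductive Term (V C : Type*) where
  | var (x : V)
  | const (c : C)

/-- An atom with predicate symbol `pred`.  Ground atoms are `Atom P C`, atoms with variables are
`Atom P (Term V C)`. -/
structure Atom (P τ : Type*) where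
  pred : P
  args : List τ

/-- A literal: an atom, or an atom under negation as failure. -/
inductive Literal (α : Type*) where
  | pos (a : α)
  | neg (a : α)

/-- The head of an ASP rule: an atom, the empty head of a constraint, or an aggregate `l{hs}u`. -/
inductive Head (α : Type*) where
  | atom (a : α)
  | constraint
  | choice (l u : ℕ) (hs : Set α)

/-- An ASP rule: a normal rule, a constraint or a choice rule, according to its head. -/
structure Rule (α : Type*) where
  head : Head α
  body : Set (Literal α)

/-- A ground definite rule, the empty head `⊥` being `none`. -/
structure DefiniteRule (α : Type*) where
  head : Option α
  body : Set α

section Maps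

variable {α β : Type*}

def Literal.map (f : α → β) : Literal α → Literal β
  | .pos a => .pos (f a)
  | .neg a => .neg (f a)

/-- The atom of a literal. -/
def Literal.atom : Literal α → α
  | .pos a => a
  | .neg a => a

/-- Truth of a literal in an interpretation. -/
def Literal.Holds (I : Set α) : Literal α → Prop
  | .pos a => a ∈ I
  | .neg a => a ∉ I

def Head.map (f : α → β) : Head α → Head β
  | .atom a => .atom (f a)
  | .constraint => .constraint
  | .choice l u hs => .choice l u (f '' hs)

def Rule.map (f : α → β) (r : Rule α) : Rule β :=
  ⟨r.head.map f, Literal.map f '' r.body⟩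

end Maps

section Semantics

variable {P C V α : Type*}

def Term.subst (σ : V → C) : Term V C → C
  | .var x => σ x
  | .const c => c

/-- The ground instance of an atom under a ground substitution. -/
def Atom.subst (σ : V → C) (a : Atom P (Term V C)) : Atom P C :=
  ⟨a.pred, a.args.map (Term.subst σ)⟩

/-- A ground atom seen as an atom of the first-order language. -/
def Atom.lift (V : Type*) (a : Atom P C) : Atom P (Term V C) :=
  ⟨a.pred, a.args.map Term.const⟩

/-- The grounding of a program over the Herbrand universe `C`, the constants of the language. -/
def grounding (Q : Set (Rule (Atom P (Term V C)))) : Set (Rule (Atom P C)) :=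
  {ρ | ∃ r ∈ Q, ∃ σ : V → C, ρ = r.map (Atom.subst σ)}

/-- `d` is one of the rules by which the rule `r`, whose negative literals are satisfied by `I`, is
replaced in the reduct: constraints, and choice rules with an aggregate that `I` does not
satisfy, get the head `⊥`; the other choice rules give one rule for each head atom in `I`. -/
def Head.ReducesTo (I : Set α) : Head α → Option α → Prop
  | .atom a, h => h = some a
  | .constraint, h => h = none
  | .choice l u hs, h =>
      let sat : Prop := (l : ℕ∞) ≤ (I ∩ hs).encard ∧ (I ∩ hs).encard ≤ (u : ℕ∞)
      (sat ∧ ∃ a ∈ I ∩ hs, h = some a) ∨ (¬ sat ∧ h = none)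

/-- The reduct of a ground program with respect to `I`. -/
def reduct (G : Set (Rule α)) (I : Set α) : Set (DefiniteRule α) :=
  {d | ∃ r ∈ G, (∀ a, Literal.neg a ∈ r.body → a ∉ I) ∧
    d.body = {a | Literal.pos a ∈ r.body} ∧ r.head.ReducesTo I d.head}

/-- `I` (which does not contain `⊥`) is a model of a set of definite rules. -/
def IsModel (D : Set (DefiniteRule α)) (I : Set α) : Prop :=
  ∀ d ∈ D, d.body ⊆ I → ∃ a ∈ I, d.head = some a

/-- `AS(Q)`: the interpretations that are the minimal model of their reduct. -/
def answerSets (Q : Set (Rule (Atom P (Term V C)))) : Set (Set (Atom P C)) :=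
  {I | Minimal (IsModel (reduct (grounding Q) I)) I}

end Semantics

/-! ### Rules of hypotheses, and mode biases -/

/-- A normal rule with variables in `V` and constants in `C`. -/
structure NormalRule (P C V : Type*) where
  head : Atom P (Term V C)
  body : Finset (Literal (Atom P (Term V C)))

section NormalRules

variable {P C V : Type*}

/-- `r.IsSubrule r'` is the relation `r ≤ r'`. -/
def NormalRule.IsSubrule (r r' : NormalRule P C V) : Prop :=
  r.head = r'.head ∧ r.body ⊆ r'.body

def NormalRule.IsStrictSubrule (r r' : NormalRule P C V) : Prop :=
  r.IsSubrule r' ∧ r ≠ r'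

/-- The number of literals of a rule, its head included. -/
def NormalRule.length (r : NormalRule P C V) : ℕ := 1 + r.body.card

/-- The number of literals of a hypothesis. -/
def hypLength (H : Finset (NormalRule P C V)) : ℕ := ∑ r ∈ H, r.length

def NormalRule.toRule (r : NormalRule P C V) : Rule (Atom P (Term V C)) :=
  ⟨.atom r.head, ↑r.body⟩

/-- The program `A ∪ H`, the ground atoms of `A` being facts. -/
def withFacts (A : Set (Atom P C)) (H : Set (NormalRule P C V)) :
    Set (Rule (Atom P (Term V C))) :=
  {r | ∃ a ∈ A, r = ⟨.atom (a.lift V), ∅⟩} ∪ NormalRule.toRule '' H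

/-- The rule `r` proves the ground atom `a` in the interpretation `p`: some ground instance of `r`
has head `a` and a body that is true in `p`. -/
def NormalRule.Proves (r : NormalRule P C V) (p : Set (Atom P C)) (a : Atom P C) : Prop :=
  ∃ σ : V → C, r.head.subst σ = a ∧ ∀ l ∈ r.body, (l.map (Atom.subst σ)).Holds p

end NormalRules

/-- An argument `var(t)` or `const(t)` of a mode declaration. -/
inductive ModeArg (Ty : Type*) where
  | var (t : Ty)
  | const (t : Ty)

structure ModeDecl (P Ty : Type*) where
  pred : P
  args : List (ModeArg Ty)

/-- A mode bias.  `varType` gives the typed variables that rules may use, `constType` the types of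
the constants.  A body declaration `.neg m` allows the atoms of `m` under negation as failure.
`admissible` stands for arbitrary further syntactic constraints put on the rules by the bias
(bounds on the size, capture and release arguments, one representative for each class of rules
that agree up to a symmetry of arguments, ...); it is `Set.univ` when there are none. -/
structure ModeBias (P C V Ty : Type*) where
  varType : V → Option Ty
  constType : C → Set Ty
  heads : Set (ModeDecl P Ty)
  bodies : Set (Literal (ModeDecl P Ty))
  admissible : Set (NormalRule P C V)

namespace ModeBias

variable {P C V Ty : Type*} (M : ModeBias P C V Ty)

def ArgCompatible : Term V C → ModeArg Ty → Prop
  | .var x, .var t => M.varType x = some t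
  | .const c, .const t => t ∈ M.constType c
  | _, _ => False

def Compatible (a : Atom P (Term V C)) (m : ModeDecl P Ty) : Prop :=
  a.pred = m.pred ∧ List.Forall₂ M.ArgCompatible a.args m.args

def LitCompatible : Literal (Atom P (Term V C)) → Literal (ModeDecl P Ty) → Prop
  | .pos a, .pos m => M.Compatible a m
  | .neg a, .neg m => M.Compatible a m
  | _, _ => False

/-- The hypothesis space `S_M`. -/
def space : Set (NormalRule P C V) :=
  {r | (∃ m ∈ M.heads, M.Compatible r.head m) ∧
    (∀ l ∈ r.body, ∃ m ∈ M.bodies, M.LitCompatible l m) ∧ r ∈ M.admissible}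

end ModeBias

/-! ### NeuralFastLAS tasks -/

/-- A raw-data example. -/
structure RawExample (P C X : Type*) where
  id : ℕ
  inc : Set (Atom P C)
  exc : Set (Atom P C)
  disj : Disjoint inc exc
  raw : X

/-- A NeuralFastLAS task `⟨B, M, E, 𝒵, Θ⟩`.  The latent space is `𝒵₁ × ⋯ × 𝒵ₙ`, where `𝒵ᵢ` is the
finite set `Z i` of constants; `nn` is the reserved predicate, and `idx i` the constant that
names the `i`-th raw input.  `net θ x` is the distribution `P_θ(· | x)` on the latent space. -/
structure Task (P C V Ty X Θ : Type*) where
  B : Set (Rule (Atom P (Term V C)))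
  M : ModeBias P C V Ty
  E : Finset (RawExample P C X)
  nn : P
  n : ℕ
  idx : Fin n → C
  idx_injective : Function.Injective idx
  Z : Fin n → Finset C
  net : Θ → X → PMF ((i : Fin n) → {c // c ∈ Z i})

namespace Task

variable {P C V Ty X Θ : Type*} (T : Task P C V Ty X Θ)

/-- The latent space `𝒵`. -/
abbrev Latent : Type _ := (i : Fin T.n) → {c // c ∈ T.Z i}

/-- The ground atom `nn(i, c)`. -/
def nnAtom (i : Fin T.n) (c : C) : Atom P C := ⟨T.nn, [T.idx i, c]⟩

/-- The atoms `nn(i, c)` with `c ∈ 𝒵ᵢ`. -/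
def nnAtoms : Set (Atom P C) := {a | ∃ i, ∃ c ∈ T.Z i, a = T.nnAtom i c}

/-- The set of atoms that represents the latent label `z`. -/
def latentAtoms (z : T.Latent) : Set (Atom P C) := Set.range fun i => T.nnAtom i (z i)

/-- The program `P_𝒵`: the choice rule `1{nn(i, c) : c ∈ 𝒵ᵢ}1.` for each `i`. -/
def latentProgram : Set (Rule (Atom P (Term V C))) :=
  Set.range fun i => ⟨.choice 1 1 ((fun c => (T.nnAtom i c).lift V) '' (T.Z i : Set C)), ∅⟩

/-- The possibilities: `poss(e) = AS(B ∪ P_𝒵)`, for every example `e`. -/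
def poss : Set (Set (Atom P C)) := answerSets (T.B ∪ T.latentProgram)

/-- A program accepts an example if one of its answer sets contains all its inclusions and none of
its exclusions. -/
def Accepts (Q : Set (Rule (Atom P (Term V C)))) (e : RawExample P C X) : Prop :=
  ∃ A ∈ answerSets Q, e.inc ⊆ A ∧ A ∩ e.exc = ∅

/-- `cov(H, e)`: the network outputs that can be used by `H` to cover `e`. -/
def cov (H : Set (NormalRule P C V)) (e : RawExample P C X) : Set T.Latent :=
  {z | ∃ A ∈ T.poss, A ∩ T.nnAtoms = T.latentAtoms z ∧ Accepts (withFacts A H) e}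

/-- No predicate of `M_h` occurs in `M_b` or in the body of a rule of the background knowledge. -/
def NonRecursive : Prop :=
  ∀ m ∈ T.M.heads,
    (∀ m' ∈ T.M.bodies, m'.atom.pred ≠ m.pred) ∧
    (∀ r ∈ T.B, ∀ l ∈ r.body, l.atom.pred ≠ m.pred)

/-- `(H, θ)` is a solution: `H ⊆ S_M`, and `H` covers every example with latent labels that the
network `θ` predicts (with positive probability) for the raw data of the example. -/
def IsSolution (H : Finset (NormalRule P C V)) (θ : Θ) : Prop :=
  (H : Set (NormalRule P C V)) ⊆ T.M.space ∧
  ∀ e ∈ T.E, ∃ z ∈ T.cov H e, 0 < T.net θ e.raw z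

/-- `θ` is a perfect network for the ground truth labelling `gt` of the raw data. -/
def IsPerfect (gt : X → T.Latent) (θ : Θ) : Prop := ∀ x, T.net θ x (gt x) = 1

/-! ### The opt-sufficient subset -/

/-- The rules of `S` that are maximal in the subrule order. -/
def maximalRules (S : Set (NormalRule P C V)) : Set (NormalRule P C V) :=
  {r | r ∈ S ∧ ∀ r' ∈ S, ¬ r.IsStrictSubrule r'}

/-- `C⁺(T, p)` for a possibility `p` of the example `e`: the maximal rules that prove at least one
inclusion of `e` in `p`. -/
def Cplus (e : RawExample P C X) (p : Set (Atom P C)) : Set (NormalRule P C V) :=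
  maximalRules {r | r ∈ T.M.space ∧ ∃ a ∈ e.inc, r.Proves p a}

/-- `C⁻(T, p)`: the maximal rules that prove at least one exclusion of `e` in `p`. -/
def Cminus (e : RawExample P C X) (p : Set (Atom P C)) : Set (NormalRule P C V) :=
  maximalRules {r | r ∈ T.M.space ∧ ∃ a ∈ e.exc, r.Proves p a}

/-- The SAT-sufficient rules `C⁺(T)`. -/
def satSpace : Set (NormalRule P C V) :=
  {r | ∃ e ∈ T.E, ∃ p ∈ T.poss, r ∈ T.Cplus e p}

/-- `r` violates the possibility `p` of `e`: it is a subrule of a rule in `C⁻(T, p)`. -/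
def Violates (r : NormalRule P C V) (e : RawExample P C X) (p : Set (Atom P C)) : Prop :=
  ∃ c ∈ T.Cminus e p, r.IsSubrule c

/-- There is an example all of whose possibilities are violated by `r`. -/
def ViolatesExample (r : NormalRule P C V) : Prop :=
  ∃ e ∈ T.E, ∀ p ∈ T.poss, T.Violates r e p

/-- `r` is the common generalisation (intersection) of a non-empty set `F` of rules with the same
head. -/
def IsIntersection (r : NormalRule P C V) (F : Set (NormalRule P C V)) : Prop :=
  F.Nonempty ∧ (∀ c ∈ F, c.head = r.head) ∧ ∀ l, l ∈ r.body ↔ ∀ c ∈ F, l ∈ c.body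

/-- The generalised rules `G(T)`: the common generalisations of SAT-sufficient rules that do not
violate all of the possibilities of an example. -/
def gen : Set (NormalRule P C V) :=
  {r | (∃ F ⊆ T.satSpace, IsIntersection r F) ∧ ¬ T.ViolatesExample r}

/-- Two rules cover the same possibilities: in each possibility of each example they prove the same
inclusions, and one of them violates the possibility if and only if the other one does. -/
def SameCoverage (r r' : NormalRule P C V) : Prop :=
  ∀ e ∈ T.E, ∀ p ∈ T.poss,
    (∀ a ∈ e.inc, r.Proves p a ↔ r'.Proves p a) ∧ (T.Violates r e p ↔ T.Violates r' e p)

/-- The conditions (1), (2), (3) on an optimisation `r'` of `r`: it is a subrule of `r`; no strict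
subrule of it covers the same possibilities; it does not violate all of the possibilities of an
example. -/
def IsCandidate (r r' : NormalRule P C V) : Prop :=
  r' ∈ T.M.space ∧ r'.IsSubrule r ∧
  (¬ ∃ r'' ∈ T.M.space, r''.IsStrictSubrule r' ∧ T.SameCoverage r'' r') ∧
  ¬ T.ViolatesExample r'

/-- The neural optimisations of `r`: the candidates that are smallest among the candidates covering
the same possibilities. -/
def neuralOpt (r : NormalRule P C V) : Set (NormalRule P C V) :=
  {r' | T.IsCandidate r r' ∧
    ∀ r'', T.IsCandidate r r'' → T.SameCoverage r'' r' → r'.length ≤ r''.length}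

/-- The opt-sufficient subset. -/
def optSpace : Set (NormalRule P C V) := ⋃ r ∈ T.gen, T.neuralOpt r

end Task

end NeuralFastLAS

namespace NeuralFastLAS

/-! ### Answer sets of facts together with a non-recursive hypothesis. -/

section Programs

variable {P C V : Type*}

/-! Non-recursiveness makes acceptance a rule-by-rule matter: `A ∪ H` has the single answer set
consisting of `A` and the atoms that rules of `H` prove in `A` (`answerSets_withFacts`,
`accepts_withFacts_iff`). As violating a possibility means proving an exclusion in it
(`violates_iff`), exchanging a rule for one with the same coverage changes no verdict.

Given a solution, fix one accepted possibility per example and discard the rules that prove no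
inclusion in any of these. Each remaining rule violates no example as a whole, so it lies below a
generalised rule (`exists_gen_isSubrule`), one of whose optimisations has the same coverage and is
no longer (`exists_neuralOpt`). These optimisations form a solution that uses the same latent
labels. Applying this to a shortest solution gives the theorem. -/

theorem Atom.subst_lift (σ : V → C) (a : Atom P C) : (a.lift V).subst σ = a := by
  cases a
  simp [Atom.lift, Atom.subst, Function.comp_def, Term.subst]

theorem Literal.neg_mem_image_map {α β : Type*} {f : α → β} {s : Set (Literal α)} {b : β} :
    Literal.neg b ∈ Literal.map f '' s ↔ ∃ a, Literal.neg a ∈ s ∧ f a = b := by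
  constructor
  · rintro ⟨l | l, hl, h⟩
    · simp [Literal.map] at h
    · exact ⟨l, hl, by simpa [Literal.map] using h⟩
  · rintro ⟨a, ha, rfl⟩
    exact ⟨_, ha, rfl⟩

theorem Literal.pos_mem_image_map {α β : Type*} {f : α → β} {s : Set (Literal α)} {b : β} :
    Literal.pos b ∈ Literal.map f '' s ↔ ∃ a, Literal.pos a ∈ s ∧ f a = b := by
  constructor
  · rintro ⟨l | l, hl, h⟩
    · exact ⟨l, hl, by simpa [Literal.map] using h⟩
    · simp [Literal.map] at h
  · rintro ⟨a, ha, rfl⟩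
    exact ⟨_, ha, rfl⟩

/-- The models of the reduct of a hypothesis with facts. -/
theorem isModel_reduct_withFacts [Nonempty C] {A I J : Set (Atom P C)}
    {H : Set (NormalRule P C V)} :
    IsModel (reduct (grounding (withFacts A H)) I) J ↔
      A ⊆ J ∧ ∀ r ∈ H, ∀ σ : V → C, (∀ a, Literal.neg a ∈ r.body → a.subst σ ∉ I) →
        (∀ a, Literal.pos a ∈ r.body → a.subst σ ∈ J) → r.head.subst σ ∈ J := by
  constructor
  · intro h
    refine ⟨fun a ha => ?_, fun r hr σ hn hp => ?_⟩
    -- Facts are ground, so any substitution yields them; `Nonempty C` ensures that there is one.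
    · obtain ⟨b, hb, hab⟩ := h ⟨some a, ∅⟩
        ⟨⟨.atom a, ∅⟩, ⟨⟨.atom (a.lift V), ∅⟩, Or.inl ⟨a, ha, rfl⟩,
          fun _ => Classical.arbitrary C, by simp [Rule.map, Head.map, Atom.subst_lift]⟩,
          by simp, by simp, rfl⟩ (by simp)
      simp only [Option.some.injEq] at hab
      exact hab ▸ hb
    · obtain ⟨b, hb, hab⟩ := h ⟨some (r.head.subst σ),
          {a | Literal.pos a ∈ (r.toRule.map (Atom.subst σ)).body}⟩
        ⟨r.toRule.map (Atom.subst σ), ⟨r.toRule, Or.inr ⟨r, hr, rfl⟩, σ, rfl⟩,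
          fun a ha => by
            obtain ⟨b, hb, rfl⟩ := Literal.neg_mem_image_map.1 ha
            exact hn b hb, rfl, rfl⟩
        (fun a ha => by
          obtain ⟨b, hb, rfl⟩ := Literal.pos_mem_image_map.1 ha
          exact hp b hb)
      simp only [Option.some.injEq] at hab
      exact hab ▸ hb
  · rintro ⟨hA, hH⟩ d ⟨ρ, ⟨q, hq, σ, rfl⟩, hn, hb, hh⟩ hd
    rcases hq with ⟨a, ha, rfl⟩ | ⟨r, hr, rfl⟩
    · refine ⟨a, hA ha, ?_⟩
      simpa [Rule.map, Head.map, Head.ReducesTo, Atom.subst_lift] using hh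
    · refine ⟨r.head.subst σ, hH r hr σ (fun a ha => hn _ ?_) (fun a ha => hd ?_), hh⟩
      · exact Literal.neg_mem_image_map.2 ⟨a, ha, rfl⟩
      · rw [hb]
        exact Literal.pos_mem_image_map.2 ⟨a, ha, rfl⟩

/-- The ground atoms of `A` and those that rules of `H` prove in `A`. -/
def consequences (A : Set (Atom P C)) (H : Set (NormalRule P C V)) : Set (Atom P C) :=
  A ∪ {a | ∃ r ∈ H, r.Proves A a}

theorem NormalRule.proves_head {r : NormalRule P C V} {A : Set (Atom P C)} {σ : V → C}
    (hn : ∀ a, Literal.neg a ∈ r.body → a.subst σ ∉ A)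
    (hp : ∀ a, Literal.pos a ∈ r.body → a.subst σ ∈ A) : r.Proves A (r.head.subst σ) := by
  refine ⟨σ, rfl, ?_⟩
  rintro (a | a) ha
  · exact hp a ha
  · exact hn a ha

/-- If the predicates `D` of the heads of `H` do not occur in the bodies of `H`, then `A ∪ H` has
a single answer set. -/
theorem answerSets_withFacts [Nonempty C] {A : Set (Atom P C)} {H : Set (NormalRule P C V)}
    (D : Set P) (hhead : ∀ r ∈ H, r.head.pred ∈ D)
    (hbody : ∀ r ∈ H, ∀ l ∈ r.body, l.atom.pred ∉ D) :
    answerSets (withFacts A H) = {consequences A H} := by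
  -- Body predicates lie outside `D`, where `I` contains nothing beyond `A`: a rule whose body is
  -- true in `A` therefore survives in the reduct and fires in `J`.
  have hmin : ∀ {I J : Set (Atom P C)}, (∀ a ∈ I, a.pred ∉ D → a ∈ A) →
      IsModel (reduct (grounding (withFacts A H)) I) J → consequences A H ⊆ J := by
    intro I J hI hJ
    rw [isModel_reduct_withFacts] at hJ
    rintro a (ha | ⟨r, hr, σ, rfl, hσ⟩)
    · exact hJ.1 ha
    · refine hJ.2 r hr σ (fun a ha haI => hσ _ ha (hI _ haI (hbody r hr _ ha)))
        (fun a ha => hJ.1 (hσ _ ha))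
  -- Proved atoms have predicates in `D`, so they trigger no further rule: one round of derivation
  -- is already closed.
  have hmodel : ∀ {I : Set (Atom P C)}, A ⊆ I →
      IsModel (reduct (grounding (withFacts A H)) I) (consequences A H) := by
    intro I hI
    rw [isModel_reduct_withFacts]
    refine ⟨Set.subset_union_left, fun r hr σ hn hp => Or.inr ⟨r, hr, ?_⟩⟩
    refine NormalRule.proves_head (fun a ha haA => hn a ha (hI haA)) fun a ha => ?_
    rcases hp a ha with h | ⟨r', hr', τ, hτ, -⟩
    · exact h
    · exact absurd (congrArg Atom.pred hτ ▸ hhead r' hr') (hbody r hr _ ha)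
  have hcons : ∀ a ∈ consequences A H, a.pred ∉ D → a ∈ A := by
    rintro a (ha | ⟨r, hr, σ, rfl, -⟩) haD
    · exact ha
    · exact absurd (hhead r hr) haD
  ext I
  simp only [answerSets, Set.mem_ofPred_eq, Set.mem_singleton_iff]
  constructor
  · intro hI
    have hAI := (isModel_reduct_withFacts.1 hI.1).1
    -- Removing from `I` the atoms outside `A` whose predicate is not in `D` leaves a model of the
    -- reduct, so by minimality there are none. This is the condition that `hmin` needs.
    have hagree : I ⊆ {a ∈ I | a.pred ∉ D → a ∈ A} := by
      refine hI.2 (isModel_reduct_withFacts.2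
        ⟨fun a ha => ⟨hAI ha, fun _ => ha⟩, fun r hr σ hn hp => ⟨?_, fun h => ?_⟩⟩)
        (fun a ha => ha.1)
      · exact (isModel_reduct_withFacts.1 hI.1).2 r hr σ hn fun a ha => (hp a ha).1
      · exact absurd (hhead r hr) h
    have hle := hmin (fun a ha => (hagree ha).2) hI.1
    exact (hI.2 (hmodel hAI) hle).antisymm hle
  · rintro rfl
    exact ⟨hmodel Set.subset_union_left, fun J hJ _ => hmin hcons hJ⟩

end Programs

/-! ### The subrule order. -/

section Subrules

variable {P C V : Type*}

namespace NormalRule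

theorem IsSubrule.refl (r : NormalRule P C V) : r.IsSubrule r := ⟨rfl, fun _ h => h⟩

theorem IsSubrule.trans {r s t : NormalRule P C V} (h : r.IsSubrule s) (h' : s.IsSubrule t) :
    r.IsSubrule t :=
  ⟨h.1.trans h'.1, h.2.trans h'.2⟩

theorem IsSubrule.length_le {r s : NormalRule P C V} (h : r.IsSubrule s) :
    r.length ≤ s.length :=
  Nat.add_le_add_left (Finset.card_le_card h.2) 1

theorem IsStrictSubrule.length_lt {r s : NormalRule P C V} (h : r.IsStrictSubrule s) :
    r.length < s.length := by
  refine Nat.add_lt_add_left (Finset.card_lt_card (h.1.2.ssubset_of_ne fun hb => h.2 ?_)) 1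
  cases r
  cases s
  exact congr (congrArg NormalRule.mk h.1.1) hb

theorem Proves.of_isSubrule {r s : NormalRule P C V} {p : Set (Atom P C)} {a : Atom P C}
    (hs : s.Proves p a) (h : r.IsSubrule s) : r.Proves p a := by
  obtain ⟨σ, hσ, hb⟩ := hs
  exact ⟨σ, by rw [h.1, hσ], fun l hl => hb l (h.2 hl)⟩

end NormalRule

/-- In a finite set of rules, every rule is a subrule of a maximal one. -/
theorem exists_isSubrule_maximalRules {S : Set (NormalRule P C V)} (hS : S.Finite)
    {r : NormalRule P C V} (hr : r ∈ S) : ∃ c ∈ Task.maximalRules S, r.IsSubrule c := by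
  obtain ⟨c, ⟨hcS, hrc⟩, hmax⟩ := Set.exists_max_image {c | c ∈ S ∧ r.IsSubrule c}
    NormalRule.length (hS.subset fun c hc => hc.1) ⟨r, hr, .refl r⟩
  exact ⟨c, ⟨hcS, fun r' hr' hlt =>
    (hlt.length_lt.trans_le (hmax r' ⟨hr', hrc.trans hlt.1⟩)).false⟩, hrc⟩

end Subrules

/-! ### Coverage, optimisations and the replacement of rules. -/

namespace Task

variable {P C V Ty X Θ : Type*} {T : Task P C V Ty X Θ}

/-- The predicates of the head declarations serve as `D`: non-recursiveness keeps them out of the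
bodies of `H`, so only one answer set has to be tested. -/
theorem accepts_withFacts_iff [Nonempty C] (hrec : T.NonRecursive)
    {H : Set (NormalRule P C V)} (hH : H ⊆ T.M.space) {A : Set (Atom P C)}
    {e : RawExample P C X} :
    Accepts (withFacts A H) e ↔
      e.inc ⊆ consequences A H ∧ consequences A H ∩ e.exc = ∅ := by
  have h := answerSets_withFacts (A := A) (H := H) {q | ∃ m ∈ T.M.heads, m.pred = q}
    (fun r hr => by
      obtain ⟨m, hm, hc⟩ := (hH hr).1
      exact ⟨m, hm, hc.1.symm⟩)
    (fun r hr l hl => by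
      rintro ⟨m, hm, hml⟩
      obtain ⟨m', hm', hc⟩ := (hH hr).2.1 l hl
      refine (hrec m hm).1 m' hm' ?_
      rw [hml]
      rcases l with a | a <;> rcases m' with m' | m' <;>
        simp only [ModeBias.LitCompatible] at hc
      · exact hc.1.symm
      · exact hc.1.symm)
  simp [Accepts, h]

/-- A rule of the hypothesis space violates a possibility if and only if it proves an exclusion
there. -/
theorem violates_iff (hfin : T.M.space.Finite) {r : NormalRule P C V} (hr : r ∈ T.M.space)
    {e : RawExample P C X} {p : Set (Atom P C)} :
    T.Violates r e p ↔ ∃ a ∈ e.exc, r.Proves p a := by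
  constructor
  · rintro ⟨c, ⟨⟨-, a, ha, hca⟩, -⟩, hrc⟩
    exact ⟨a, ha, hca.of_isSubrule hrc⟩
  · intro h
    exact exists_isSubrule_maximalRules (hfin.subset fun _ hc => hc.1) ⟨hr, h⟩

theorem SameCoverage.refl (r : NormalRule P C V) : T.SameCoverage r r :=
  fun _ _ _ _ => ⟨fun _ _ => Iff.rfl, Iff.rfl⟩

theorem SameCoverage.trans {r s t : NormalRule P C V} (h : T.SameCoverage r s)
    (h' : T.SameCoverage s t) : T.SameCoverage r t :=
  fun e he p hp => ⟨fun a ha => ((h e he p hp).1 a ha).trans ((h' e he p hp).1 a ha),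
    (h e he p hp).2.trans (h' e he p hp).2⟩

theorem SameCoverage.violatesExample {r s : NormalRule P C V} (h : T.SameCoverage r s)
    (hr : T.ViolatesExample r) : T.ViolatesExample s := by
  obtain ⟨e, he, hv⟩ := hr
  exact ⟨e, he, fun p hp => (h e he p hp).2.1 (hv p hp)⟩

/-- Violation is inherited by subrules directly from its definition. Membership in `T.M.space` is
not required, which matters because a generalised rule may fall outside it. -/
theorem ViolatesExample.of_isSubrule {r s : NormalRule P C V} (hs : T.ViolatesExample s)
    (h : r.IsSubrule s) : T.ViolatesExample r := by
  obtain ⟨e, he, hv⟩ := hs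
  refine ⟨e, he, fun p hp => ?_⟩
  obtain ⟨c, hc, hsc⟩ := hv p hp
  exact ⟨c, hc, h.trans hsc⟩

/-- A rule that proves an inclusion, without violating an example, is a subrule of a generalised
rule. -/
theorem exists_gen_isSubrule (hfin : T.M.space.Finite) {r : NormalRule P C V}
    (hr : r ∈ T.M.space) (hv : ¬ T.ViolatesExample r) {e : RawExample P C X} (he : e ∈ T.E)
    {p : Set (Atom P C)} (hp : p ∈ T.poss) {a : Atom P C} (ha : a ∈ e.inc)
    (hra : r.Proves p a) : ∃ g ∈ T.gen, r.IsSubrule g := by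
  classical
  obtain ⟨c, hc, hrc⟩ := exists_isSubrule_maximalRules
    (S := {r | r ∈ T.M.space ∧ ∃ a ∈ e.inc, r.Proves p a})
    (hfin.subset fun _ hc => hc.1) ⟨hr, a, ha, hra⟩
  have hcF : c ∈ {c ∈ T.satSpace | r.IsSubrule c} := ⟨⟨e, he, p, hp, hc⟩, hrc⟩
  -- The intersection of all SAT-sufficient rules above `r`. Filtering the body of one member `c` of
  -- the family keeps it a `Finset`.
  let g : NormalRule P C V :=
    ⟨r.head, c.body.filter fun l => ∀ c' ∈ {c ∈ T.satSpace | r.IsSubrule c}, l ∈ c'.body⟩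
  have hg : r.IsSubrule g :=
    ⟨rfl, fun l hl => Finset.mem_filter.2 ⟨hrc.2 hl, fun c' hc' => hc'.2.2 hl⟩⟩
  refine ⟨g, ⟨⟨_, fun _ h => h.1, ⟨c, hcF⟩, fun c' hc' => hc'.2.1.symm, fun l => ?_⟩,
    fun h => hv (h.of_isSubrule hg)⟩, hg⟩
  exact ⟨fun hl => (Finset.mem_filter.1 hl).2,
    fun hl => Finset.mem_filter.2 ⟨hl c hcF, hl⟩⟩

/-- A rule without violated examples has, among the optimisations of any rule above it, one that
covers the same possibilities and is not longer. -/
theorem exists_neuralOpt {r g : NormalRule P C V} (hr : r ∈ T.M.space)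
    (hv : ¬ T.ViolatesExample r) (hrg : r.IsSubrule g) :
    ∃ s ∈ T.neuralOpt g, T.SameCoverage s r ∧ s.length ≤ r.length := by
  have hwf : WellFounded fun s t : NormalRule P C V => s.length < t.length :=
    (measure NormalRule.length).wf
  -- A shortest subrule of `r` with the same coverage satisfies condition (2), since a strict
  -- subrule would be shorter still.
  obtain ⟨q, ⟨hq, hqr, hcov⟩, hqmin⟩ := hwf.has_min
    {q | q ∈ T.M.space ∧ q.IsSubrule r ∧ T.SameCoverage q r} ⟨r, hr, .refl r, .refl r⟩
  have hqc : T.IsCandidate g q := by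
    refine ⟨hq, hqr.trans hrg, ?_, fun h => hv (hcov.violatesExample h)⟩
    rintro ⟨t, ht, htq, htcov⟩
    exact hqmin t ⟨ht, htq.1.trans hqr, htcov.trans hcov⟩ htq.length_lt
  -- `s` lies below `g` but need not be a subrule of `r`; its length is bounded through `q`.
  obtain ⟨s, ⟨hs, hsq⟩, hsmin⟩ := hwf.has_min
    {s | T.IsCandidate g s ∧ T.SameCoverage s q} ⟨q, hqc, .refl q⟩
  exact ⟨s, ⟨hs, fun t ht hts => not_lt.1 (hsmin t ⟨ht, hts.trans hsq⟩)⟩, hsq.trans hcov,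
    (not_lt.1 (hsmin q ⟨hqc, .refl q⟩)).trans hqr.length_le⟩

theorem neuralOpt_subset_space (g : NormalRule P C V) : T.neuralOpt g ⊆ T.M.space :=
  fun _ h => h.1.1

/-- Every solution can be replaced by one within the opt-sufficient subset that is not longer. -/
theorem IsSolution.exists_subset_optSpace [Nonempty C] (hrec : T.NonRecursive)
    (hfin : T.M.space.Finite) {θ : Θ} {H : Finset (NormalRule P C V)}
    (hH : T.IsSolution H θ) :
    ∃ H' : Finset (NormalRule P C V), (H' : Set (NormalRule P C V)) ⊆ T.optSpace ∧
      T.IsSolution H' θ ∧ hypLength H' ≤ hypLength H := by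
  classical
  obtain ⟨hsub, hcov⟩ := hH
  -- `z` keeps the membership proof as an argument because `T.Latent` may be empty; `A` has an
  -- arbitrary value outside `T.E`.
  choose z hz hpos using hcov
  choose! A hA hAz hacc using hz
  simp only [accepts_withFacts_iff hrec hsub] at hacc
  have hexc : ∀ r ∈ H, ∀ e ∈ T.E, ¬ T.Violates r e (A e) := by
    intro r hr e he h
    obtain ⟨a, ha, hra⟩ := (violates_iff hfin (hsub hr)).1 h
    have : a ∈ consequences (A e) (H : Set (NormalRule P C V)) ∩ e.exc :=
      ⟨Or.inr ⟨r, hr, hra⟩, ha⟩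
    rw [(hacc e he).2] at this
    exact this
  -- Only rules that prove some inclusion are kept: the others need not lie below a generalised
  -- rule, and dropping them loses no inclusion.
  have hopt : ∀ r ∈ {r ∈ H | ∃ e ∈ T.E, ∃ a ∈ e.inc, r.Proves (A e) a},
      ∃ s, s ∈ T.optSpace ∧ s ∈ T.M.space ∧ T.SameCoverage s r ∧ s.length ≤ r.length := by
    intro r hr
    obtain ⟨hrH, e, he, a, ha, hra⟩ := Finset.mem_filter.1 hr
    have hv : ¬ T.ViolatesExample r := by
      rintro ⟨e, he, hv⟩
      exact hexc r hrH e he (hv _ (hA e he))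
    obtain ⟨g, hg, hrg⟩ := exists_gen_isSubrule hfin (hsub hrH) hv he (hA e he) ha hra
    obtain ⟨s, hs, hsr, hlen⟩ := exists_neuralOpt (hsub hrH) hv hrg
    exact ⟨s, Set.mem_biUnion hg hs, neuralOpt_subset_space g hs, hsr, hlen⟩
  choose! f hfopt hfsp hfcov hflen using hopt
  set U := {r ∈ H | ∃ e ∈ T.E, ∃ a ∈ e.inc, r.Proves (A e) a} with hU
  have hsub' : (U.image f : Set (NormalRule P C V)) ⊆ T.M.space := by
    intro s hs
    obtain ⟨r, hr, rfl⟩ := Finset.mem_image.1 hs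
    exact hfsp r hr
  refine ⟨U.image f, ?_, ⟨hsub', fun e he => ⟨z e he, ⟨A e, hA e he, hAz e he, ?_⟩, hpos e he⟩⟩, ?_⟩
  · intro s hs
    obtain ⟨r, hr, rfl⟩ := Finset.mem_image.1 hs
    exact hfopt r hr
  · rw [accepts_withFacts_iff hrec hsub']
    constructor
    · intro a ha
      rcases (hacc e he).1 ha with h | ⟨r, hr, hra⟩
      · exact Or.inl h
      · have hrU : r ∈ U := Finset.mem_filter.2 ⟨hr, e, he, a, ha, hra⟩
        exact Or.inr ⟨f r, Finset.mem_image_of_mem f hrU,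
          ((hfcov r hrU e he _ (hA e he)).1 a ha).2 hra⟩
    · refine Set.eq_empty_of_forall_notMem ?_
      rintro a ⟨h | ⟨s, hs, hsa⟩, ha⟩
      · have : a ∈ consequences (A e) (H : Set (NormalRule P C V)) ∩ e.exc := ⟨Or.inl h, ha⟩
        rw [(hacc e he).2] at this
        exact this
      · obtain ⟨r, hr, rfl⟩ := Finset.mem_image.1 hs
        exact hexc r (Finset.mem_filter.1 hr).1 e he ((hfcov r hr e he _ (hA e he)).2.1
          ((violates_iff hfin (hfsp r hr)).2 ⟨a, ha, hsa⟩))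
  -- Distinct rules may share an optimisation, which only shortens the image.
  · calc hypLength (U.image f) ≤ ∑ r ∈ U, (f r).length :=
          Finset.sum_image_le_of_nonneg fun _ _ => Nat.zero_le _
      _ ≤ ∑ r ∈ U, r.length := Finset.sum_le_sum hflen
      _ ≤ hypLength H := Finset.sum_le_sum_of_subset (Finset.filter_subset _ _)

end Task

end NeuralFastLAS

theorem mainTheorem1 {P C V Ty X Θ : Type*} [Nonempty C]
    (T : NeuralFastLAS.Task P C V Ty X Θ)
    (hrec : T.NonRecursive) (hfin : T.M.space.Finite)
    (gt : X → T.Latent) (θ : Θ) (hperfect : T.IsPerfect gt θ)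
    (hsat : ∃ H₀, T.IsSolution H₀ θ) :
    ∃ H : Finset (NeuralFastLAS.NormalRule P C V),
      (↑H : Set (NeuralFastLAS.NormalRule P C V)) ⊆ T.optSpace ∧
      T.IsSolution H θ ∧
      ∀ H', T.IsSolution H' θ → NeuralFastLAS.hypLength H ≤ NeuralFastLAS.hypLength H' := by
  obtain ⟨H₁, hH₁, hmin⟩ := (measure NeuralFastLAS.hypLength).wf.has_min
    {H | T.IsSolution H θ} hsat
  obtain ⟨H, hopt, hsol, hlen⟩ := hH₁.exists_subset_optSpace hrec hfin
  exact ⟨H, hopt, hsol, fun H' hH' => hlen.trans (not_lt.1 (hmin H' hH'))⟩
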